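/- Let $k$ be a commutative ring (a field, say; for $k=\mathbb{Z}$ the $k$-linearity below is no extra structure or condition). Rings are unital. A ring $A$ is *regular* if every $x\in A$ has the form $x=xyx$ with $y\in A$, and *right self-injective* if it is injective as a right module over itself. A *factor* is a regular ring whose only central idempotents are $0$ and $1$. A right module is *isominimal* if it is isomorphic to each of its non-zero direct summands; a ring $A$ is isominimal if the right module $A_A$ is, and an element $x\in A$ is isominimal if the right module $xA$ is. For a regular right self-injective ring $A$, let $\mathcal{M}_A^r$ be the full subcategory of the category of right $A$-modules consisting of the modules that are direct summands of powers $A^I$, for sets $I$. A category $\mathcal{C}$ is a *singleton category* if it has an object $x$ such that every object of $\mathcal{C}$ is a (possibly empty) coproduct of copies of $x$. Let $\mathcal{C}$ be a $k$-linear Grothendieck category that is non-trivial (has a non-zero object). Then the following conditions are equivalent: 1. $\mathcal{C}$ is a singleton category. 2. $\mathcal{C}$ is equivalent, as a $k$-linear category, to $\mathcal{M}_A^r$ for some non-zero $k$-algebra $A$ that is regular, right self-injective and isominimal. 3. $\mathcal{C}$ is equivalent, as a $k$-linear category, to $\mathcal{M}_A^r$ for some $k$-algebra $A$ that is a right self-injective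 factor and contains a non-zero isominimal idempotent $e\in A$. -/

import Mathlib

open CategoryTheory CategoryTheory.Limits

universe v u t

/-- A category is a singleton category if it has an object `x` such that every object is a
(possibly empty, small) coproduct of copies of `x`. -/
def IsSingletonCategory (C : Type u) [Category.{v} C] : Prop :=
  ∃ x : C, ∀ y : C, ∃ (S : Type v) (i : S → (x ⟶ y)), Nonempty (IsColimit (Cofan.mk y i))

/-- A (unital) ring is von Neumann regular if every `x` has the form `x * y * x`. -/
def IsVonNeumannRegular (A : Type v) [Ring A] : Prop :=
  ∀ x : A, ∃ y : A, x = x * y * x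

/-- A ring is right self-injective if it is injective as a right module over itself.
Right `A`-modules are modules over the opposite ring `Aᵐᵒᵖ`. -/
def IsRightSelfInjective (A : Type v) [Ring A] : Prop :=
  Module.Injective Aᵐᵒᵖ A

/-- A module is isominimal if it is isomorphic to all of its non-zero direct summands. -/
def IsIsominimalModule (R : Type v) [Ring R] (M : Type v) [AddCommGroup M] [Module R M] : Prop :=
  ∀ N : Submodule R M, (∃ N' : Submodule R M, IsCompl N N') → N ≠ ⊥ → Nonempty (M ≃ₗ[R] N)

/-- A ring is isominimal if it is isominimal as a right module over itself. -/
def IsIsominimalRing (A : Type v) [Ring A] : Prop :=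
  IsIsominimalModule Aᵐᵒᵖ A

/-- The principal right ideal `x A`, as a right module. -/
def principalRightIdeal {A : Type v} [Ring A] (x : A) : Submodule Aᵐᵒᵖ A :=
  Submodule.span Aᵐᵒᵖ {x}

/-- An element `x` of a ring `A` is isominimal if the right module `x A` is. -/
def IsIsominimalElement {A : Type v} [Ring A] (x : A) : Prop :=
  IsIsominimalModule Aᵐᵒᵖ (principalRightIdeal x)

/-- A factor is a regular ring whose only central idempotents are `0` and `1`. -/
structure IsRegularFactor (A : Type v) [Ring A] : Prop where
  regular : IsVonNeumannRegular A
  central_idempotent : ∀ e : A, e ∈ Subring.center A → IsIdempotentElem e → e = 0 ∨ e = 1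

/-- The right `A`-modules that are direct summands of a power `A ^ I` for some (small) set `I`. -/
def IsReducedModule (A : Type v) [Ring A] : ObjectProperty (ModuleCat.{v} Aᵐᵒᵖ) :=
  fun M => ∃ (I : Type v) (i : M →ₗ[Aᵐᵒᵖ] (I → A)) (r : (I → A) →ₗ[Aᵐᵒᵖ] M),
    r ∘ₗ i = LinearMap.id

/-- The category of right `A`-modules that are direct summands of powers of `A`, a full subcategory
of the category of all right `A`-modules. -/
abbrev ReducedModuleCat (A : Type v) [Ring A] : Type (v + 1) :=
  (IsReducedModule A).FullSubcategory

/-- For a `k`-algebra `A`, a `k`-linear category `C` is equivalent to the category of right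
`A`-modules that are direct summands of powers of `A`, through a `k`-linear equivalence.
An element `r` of `k` acts on a right `A`-module through its image in `A`; the condition on `e` says
that `e` sends `r • f` to `r` times the image of `f`. -/
def EquivReducedModuleCat (k : Type t) [CommRing k] (C : Type u) [Category.{v} C] [Preadditive C]
    [Linear k C] (A : Type v) [Ring A] [Algebra k A] : Prop :=
  ∃ e : C ≌ ReducedModuleCat A, ∀ (X Y : C) (f : X ⟶ Y) (r : k) (m : (e.functor.obj X).obj),
    (e.functor.map (r • f)).hom.hom m =
      MulOpposite.op (algebraMap k A r) • (e.functor.map f).hom.hom m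

/-! Everything takes place in Grothendieck categories whose objects are all injective, so that
monomorphisms and epimorphisms split. If every object is a coproduct of copies of x, a diagonal
argument on cardinals makes every object injective (`injective_of_forall_iso_sigma`). A non-zero
retract of x contains a copy of x, so Cantor-Bernstein (`nonempty_iso_of_retracts`) makes x
isominimal. As x is a separator, Gabriel-Popescu makes Hom(x, -) fully faithful into right modules
over End x. Its values are summands of powers, since coproducts embed in products, and splitting
idempotents shows that all such summands occur. Isominimality of A leaves no room for a proper
central idempotent, whence 3 with e = 1. Conversely, let e be isominimal in a factor A. By Zorn,
each object is a coproduct of copies of eA plus a part receiving no non-zero map from eA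
(`IsIsominimalObject.exists_decomposition`). For the object A this splitting is given by a central
idempotent, so the second part is zero and eA is a separator. The second part then vanishes for
every object. -/

namespace SingletonCategory

/-! ### Splitting when all objects are injective -/

section Spectral

variable {C : Type u} [Category.{v} C]

/-- In a category all of whose objects are injective, every monomorphism splits. -/
lemma exists_retraction (hinj : ∀ X : C, Injective X) {X Y : C} (f : X ⟶ Y) [Mono f] :
    ∃ r : Y ⟶ X, f ≫ r = 𝟙 X :=
  (hinj X).factors (𝟙 X) f

variable [Abelian C]

/-- In an abelian category all of whose objects are injective, every epimorphism splits. -/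
lemma exists_section (hinj : ∀ X : C, Injective X) {X Y : C} (f : X ⟶ Y) [Epi f] :
    ∃ s : Y ⟶ X, s ≫ f = 𝟙 Y := by
  obtain ⟨r, hr⟩ := exists_retraction hinj (kernel.ι f)
  -- The projection complementary to the kernel descends along `f` to a section.
  have h : kernel.ι f ≫ (𝟙 X - r ≫ kernel.ι f) = 0 := by
    rw [Preadditive.comp_sub, Category.comp_id, reassoc_of% hr, sub_self]
  refine ⟨Abelian.epiDesc f _ h, ?_⟩
  rw [← cancel_epi f, Abelian.comp_epiDesc_assoc]
  simp

lemma section_comp {X Y : C} {f : X ⟶ Y} {s : image f ⟶ X}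
    (hs : s ≫ factorThruImage f = 𝟙 (image f)) : s ≫ f = image.ι f := by
  have h := s ≫= image.fac f
  rwa [reassoc_of% hs, eq_comm] at h

/-- In an abelian category all of whose objects are injective, every morphism has a
quasi-inverse. -/
lemma exists_quasiInverse (hinj : ∀ X : C, Injective X) {X Y : C} (f : X ⟶ Y) :
    ∃ g : Y ⟶ X, f ≫ g ≫ f = f := by
  obtain ⟨r, hr⟩ := exists_retraction hinj (image.ι f)
  obtain ⟨s, hs⟩ := exists_section hinj (factorThruImage f)
  refine ⟨r ≫ s, ?_⟩
  rw [Category.assoc, section_comp hs]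
  have h : f ≫ r = factorThruImage f := by
    have := image.fac f =≫ r
    rw [Category.assoc, hr, Category.comp_id] at this
    exact this.symm
  rw [reassoc_of% h, image.fac]

/-- An object is isominimal if it is isomorphic to each of its non-zero retracts. -/
def IsIsominimalObject {C : Type u} [Category.{v} C] (x : C) : Prop :=
  ∀ (z : C) (i : z ⟶ x) (r : x ⟶ z), i ≫ r = 𝟙 z → ¬ IsZero z → Nonempty (x ≅ z)

/-- A non-zero morphism out of an isominimal object yields a monomorphism out of it, which
factors through the given morphism. -/
lemma IsIsominimalObject.exists_mono (hinj : ∀ X : C, Injective X) {x y : C}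
    (hx : IsIsominimalObject x) (g : x ⟶ y) (hg : g ≠ 0) :
    ∃ h : x ⟶ x, Mono (h ≫ g) := by
  obtain ⟨s, hs⟩ := exists_section hinj (factorThruImage g)
  obtain ⟨e⟩ := hx (image g) s (factorThruImage g) hs fun h0 => hg (by
    rw [← image.fac g, h0.eq_of_src (image.ι g) 0, comp_zero])
  have h : (e.hom ≫ s) ≫ g = e.hom ≫ image.ι g := by
    rw [Category.assoc, section_comp hs]
  exact ⟨e.hom ≫ s, h ▸ inferInstance⟩

end Spectral

/-! ### Coproducts of copies of one object -/

section Coproducts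

variable {C : Type u} [Category.{v} C] [Abelian C] [IsGrothendieckAbelian.{v} C]

/-- The inclusion of a subcoproduct admits a retraction. -/
lemma exists_retraction_subcoproduct {S T : Type v} (x : C) (e : T → S)
    (he : Function.Injective e) :
    ∃ r : (∐ fun _ : S => x) ⟶ ∐ fun _ : T => x,
      Sigma.desc (fun t : T => Sigma.ι (fun _ : S => x) (e t)) ≫ r = 𝟙 _ := by
  classical
  refine ⟨Sigma.desc fun s => if h : ∃ t, e t = s then Sigma.ι (fun _ : T => x) h.choose else 0,
    Sigma.hom_ext _ _ fun t => ?_⟩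
  have h : ∃ t', e t' = e t := ⟨t, rfl⟩
  have h' : h.choose = t := he h.choose_spec
  rw [colimit.ι_desc_assoc, Cofan.mk_ι_app, colimit.ι_desc, Cofan.mk_ι_app, dif_pos h, h',
    Category.comp_id]

lemma sigmaDesc_comp_sigmaDesc {S T : Type v} {x y : C} (f : S → (x ⟶ y)) (e : T → S) :
    Sigma.desc (fun t : T => Sigma.ι (fun _ : S => x) (e t)) ≫ Sigma.desc f =
      Sigma.desc fun t => f (e t) :=
  Sigma.hom_ext _ _ fun t => by simp

/-- The restriction of a monomorphism to a subcoproduct is a monomorphism. -/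
lemma mono_sigmaDesc_comp {S T : Type v} {x y : C} (f : S → (x ⟶ y)) [Mono (Sigma.desc f)]
    (e : T → S) (he : Function.Injective e) : Mono (Sigma.desc fun t => f (e t)) := by
  obtain ⟨r, hr⟩ := exists_retraction_subcoproduct x e he
  have : IsSplitMono (Sigma.desc fun t : T => Sigma.ι (fun _ : S => x) (e t)) := ⟨⟨r, hr⟩⟩
  rw [← sigmaDesc_comp_sigmaDesc]
  infer_instance

attribute [local instance] IsFiltered.isConnected in
/-- In a Grothendieck category, a morphism out of a coproduct is a monomorphism if its
restrictions to all finite subcoproducts are. -/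
lemma mono_sigmaDesc_of_finite {S : Type v} {x y : C} (f : S → (x ⟶ y))
    (h : ∀ (T : Type v) [Finite T] (e : T → S), Function.Injective e →
      Mono (Sigma.desc fun t => f (e t))) : Mono (Sigma.desc f) := by
  refine Preadditive.mono_of_cancel_zero _ fun {T} a ha => ?_
  suffices a ≫ 𝟙 _ = 0 by simpa using this
  -- By exactness of filtered colimits, `a` vanishes if it does on its pullback along each finite
  -- subcoproduct.
  refine (CoproductsFromFiniteFiltered.isColimitFiniteSubproductsCocone
    (fun _ : S => x)).pullback_zero_ext fun F => ?_
  have := h F (fun s => s.1.as) fun a b hab => Subtype.ext (Discrete.ext hab)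
  obtain ⟨P, p, q, hpq, hq⟩ : ∃ (P : C) (p : P ⟶ ∐ fun _ : F => x) (q : P ⟶ T),
      p ≫ Sigma.desc (fun s : F => Sigma.ι (fun _ : S => x) s.1.as) = q ≫ a ∧
        (q ≫ a = 0 → pullback.snd (((CoproductsFromFiniteFiltered.finiteSubcoproductsCocone
          (fun _ : S => x)).ι.app F)) a ≫ a ≫ 𝟙 _ = 0) :=
    ⟨_, pullback.fst (((CoproductsFromFiniteFiltered.finiteSubcoproductsCocone
      (fun _ : S => x)).ι.app F)) a, pullback.snd _ _, pullback.condition,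
      fun h => (congrArg _ (Category.comp_id a)).trans h⟩
  have hp : p = 0 := by
    rw [← cancel_mono (Sigma.desc fun s : F => f s.1.as), zero_comp,
      ← sigmaDesc_comp_sigmaDesc f (fun s : F => s.1.as), reassoc_of% hpq, ha, comp_zero]
  exact hq (by rw [← hpq, hp, zero_comp])

/-- In a Grothendieck category, the canonical morphism from a coproduct to a product is a
monomorphism. -/
lemma mono_sigma_to_pi (S : Type v) (x : C) :
    ∃ f : (∐ fun _ : S => x) ⟶ (∏ᶜ fun _ : S => x), Mono f := by
  classical
  refine ⟨Sigma.desc fun s => Pi.lift fun s' => if s = s' then 𝟙 x else 0,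
    mono_sigmaDesc_of_finite _ fun T _ e he => ?_⟩
  have := Fintype.ofFinite T
  -- On a finite subcoproduct, the finite sum of projections followed by inclusions is a retraction.
  refine (⟨⟨∑ t : T, Pi.π _ (e t) ≫ Sigma.ι (fun _ : T => x) t, Sigma.hom_ext _ _ fun t => ?_⟩⟩ :
    IsSplitMono _).mono
  rw [colimit.ι_desc_assoc, Cofan.mk_ι_app, Preadditive.comp_sum, Finset.sum_eq_single t]
  · simp
  · intro t' _ ht
    simp [he.ne ht.symm]
  · simp

/-- If `x` is isominimal in a Grothendieck category all of whose objects are injective, then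
every object is the sum of a coproduct of copies of `x` and of an object that receives no
non-zero morphism from `x`. -/
lemma IsIsominimalObject.exists_decomposition (hinj : ∀ X : C, Injective X) {x : C}
    (hx : IsIsominimalObject x) (hx0 : ¬ IsZero x) (y : C) :
    ∃ (S : Type v) (f : S → (x ⟶ y)) (r : y ⟶ ∐ fun _ : S => x),
      Sigma.desc f ≫ r = 𝟙 _ ∧ ∀ g : x ⟶ y, g ≫ r = 0 → g = 0 := by
  classical
  obtain ⟨S, -, hS⟩ := zorn_subset_nonempty
    {S : Set (x ⟶ y) | Mono (Sigma.desc fun s : S => s.1)} (fun c hc hchain hne => by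
      refine ⟨⋃₀ c, mono_sigmaDesc_of_finite _ fun T _ e he => ?_,
        fun s hs => Set.subset_sUnion_of_mem hs⟩
      -- A finite part of the union of a chain lies in one member, and finite parts suffice.
      obtain ⟨s, hs, hes⟩ := hchain.directedOn.exists_mem_subset_of_finite_of_subset_sUnion
        hne (Set.finite_range fun t => (e t).1) (by rintro _ ⟨t, rfl⟩; exact (e t).2)
      have : Mono (Sigma.desc fun s : s => s.1) := hc hs
      exact mono_sigmaDesc_comp (fun s : s => s.1) (fun t => ⟨(e t).1, hes ⟨t, rfl⟩⟩)
        fun a b hab => he (Subtype.ext (by simpa using hab))) ∅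
    (mono_sigmaDesc_of_finite _ fun T _ e _ => Preadditive.mono_of_cancel_zero _ fun a _ => by
      have : IsEmpty T := ⟨fun t => (e t).2⟩
      rw [← Category.comp_id a, show 𝟙 (∐ fun _ : T => x) = 0 from
        Sigma.hom_ext _ _ fun t => isEmptyElim t, comp_zero])
  have hmono : Mono (Sigma.desc fun s : S => s.1) := hS.prop
  obtain ⟨r, hr⟩ := exists_retraction hinj (Sigma.desc fun s : S => s.1)
  refine ⟨S, fun s => s.1, r, hr, fun g hg => by_contra fun hg0 => ?_⟩
  obtain ⟨h, hh⟩ := hx.exists_mono hinj g hg0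
  obtain ⟨w, hw⟩ := exists_retraction hinj (h ≫ g)
  obtain ⟨g', hg'⟩ : ∃ g', g' = h ≫ g := ⟨_, rfl⟩
  have hg'r : g' ≫ r = 0 := by rw [hg', Category.assoc, hg, comp_zero]
  rw [← hg'] at hw
  have hsr (s : S) : s.1 ≫ r = Sigma.ι (fun _ : S => x) s := by
    simpa using Sigma.ι (fun _ : S => x) s ≫= hr
  have hnot : g' ∉ S := fun hmem => hx0 ((IsZero.iff_id_eq_zero x).2 (by
    have h1 : Sigma.ι (fun _ : S => x) ⟨g', hmem⟩ = 0 := by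
      rw [← hsr ⟨g', hmem⟩, hg'r]
    have h2 : _ = g' := Sigma.ι_desc (fun s : S => s.1) ⟨g', hmem⟩
    rw [h1, zero_comp] at h2
    rw [← hw, ← h2, zero_comp]))
  refine hnot (hS.le_of_ge (y := insert g' S) ?_ (Set.subset_insert _ _)
    (Set.mem_insert _ _))
  let incl : (∐ fun _ : S => x) ⟶ ∐ fun _ : ↥(insert g' S) => x :=
    Sigma.desc fun s : S => Sigma.ι (fun _ : ↥(insert g' S) => x) ⟨s.1, Set.mem_insert_of_mem _ s.2⟩
  -- The complement of the image of S is projected to the new copy of `x` by `w`; as `g'` lies in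
  -- that complement, the enlarged family stays split, against maximality.
  refine (⟨⟨r ≫ incl + (𝟙 y - r ≫ Sigma.desc fun s : S => s.1) ≫ w ≫
    Sigma.ι (fun _ : ↥(insert g' S) => x) ⟨g', Set.mem_insert _ _⟩,
    Sigma.hom_ext _ _ fun s => ?_⟩⟩ : IsSplitMono _).mono
  rw [Sigma.ι_desc_assoc, Preadditive.comp_add, Preadditive.sub_comp, Preadditive.comp_sub,
    Category.id_comp, Category.assoc, Category.comp_id]
  obtain ⟨s, hs⟩ := s
  obtain rfl | hs' := Set.mem_insert_iff.1 hs
  · rw [reassoc_of% hg'r, reassoc_of% hg'r, reassoc_of% hw]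
    simp
  · have := hsr ⟨s, hs'⟩
    rw [reassoc_of% this, reassoc_of% this]
    simp [incl]

end Coproducts

/-! ### Separators, Cantor-Bernstein, and singleton categories -/

section

variable {C : Type u} [Category.{v} C] [Abelian C] [IsGrothendieckAbelian.{v} C]

/-- Let `x'` be a non-zero isominimal retract of a separator `x` whose endomorphism ring has no
non-trivial central idempotents. Then only zero objects receive no non-zero morphism from `x'`. -/
lemma IsIsominimalObject.isSeparator_of_central (hinj : ∀ X : C, Injective X) {x x' : C}
    (hx : IsSeparator x) (hx' : IsIsominimalObject x') (hx0 : ¬ IsZero x')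
    (i : x' ⟶ x) (q : x ⟶ x') (hiq : i ≫ q = 𝟙 x')
    (hp : ∀ p : x ⟶ x, p ≫ p = p → (∀ a : x ⟶ x, p ≫ a = a ≫ p) → p = 0 ∨ p = 𝟙 x) :
    IsSeparator x' := by
  obtain ⟨S, f, r, hr, hzero⟩ := hx'.exists_decomposition hinj hx0 x
  set d := Sigma.desc f with hd
  have hpp : (r ≫ d) ≫ (r ≫ d) = r ≫ d := by
    rw [Category.assoc, reassoc_of% hr]
  have key (g : (∐ fun _ : S => x') ⟶ x) (hg : g ≫ r = 0) : g = 0 :=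
    Sigma.hom_ext _ _ fun s => by
      rw [comp_zero]
      exact hzero _ (by rw [Category.assoc, hg, comp_zero])
  -- The image of `d` is stable under endomorphisms, since its complement receives nothing from
  -- `x'`.
  have h1 (a : x ⟶ x) : d ≫ a = d ≫ a ≫ r ≫ d := by
    rw [← sub_eq_zero]
    refine key _ ?_
    rw [Preadditive.sub_comp]
    simp only [Category.assoc, hr, Category.comp_id, sub_self]
  -- Nor does the complement map to the image of `d`: a quasi-inverse of such a map would go from
  -- copies of `x'` to the complement.
  have h2 (a : x ⟶ x) : a ≫ r = r ≫ d ≫ a ≫ r := by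
    obtain ⟨h', hh'⟩ := exists_quasiInverse hinj ((𝟙 x - r ≫ d) ≫ a ≫ r)
    have h3 : h' ≫ (𝟙 x - r ≫ d) = 0 := key _ (by
      rw [Category.assoc, Preadditive.sub_comp, Category.assoc, hr, Category.comp_id,
        Category.id_comp, sub_self, comp_zero])
    rw [reassoc_of% h3, zero_comp, comp_zero] at hh'
    rw [← sub_eq_zero]
    simpa using hh'.symm
  obtain h | h := hp (r ≫ d) hpp fun a => by
    rw [Category.assoc, h1, ← reassoc_of% (h2 a)]
  · refine absurd ((IsZero.iff_id_eq_zero x').2 ?_) hx0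
    have hr0 : r = 0 := by
      have := h =≫ r
      rwa [Category.assoc, hr, Category.comp_id, zero_comp] at this
    rw [← hiq, hzero i (by rw [hr0, comp_zero]), zero_comp]
  · rw [Preadditive.isSeparator_iff] at hx ⊢
    intro Y Z u hu
    refine hx u fun w => ?_
    rw [← Category.id_comp w, ← h, Category.assoc, Category.assoc]
    suffices d ≫ w ≫ u = 0 by rw [this, comp_zero]
    exact Sigma.hom_ext _ _ fun s => by
      rw [comp_zero, ← Category.assoc, ← Category.assoc]
      exact hu _

/-- A Grothendieck category all of whose objects are injective is a singleton category if it has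
an isominimal separator. -/
lemma IsIsominimalObject.isSingletonCategory (hinj : ∀ X : C, Injective X) {x : C}
    (hx : IsIsominimalObject x) (hx0 : ¬ IsZero x) (hsep : IsSeparator x) :
    IsSingletonCategory C := by
  refine ⟨x, fun y => ?_⟩
  obtain ⟨S, f, r, hr, hzero⟩ := hx.exists_decomposition hinj hx0 y
  have hr' : r ≫ Sigma.desc f = 𝟙 y := by
    rw [← sub_eq_zero]
    refine (Preadditive.isSeparator_iff x).1 hsep _ fun g => hzero _ ?_
    rw [Category.assoc, Preadditive.sub_comp, Category.assoc, hr, Category.comp_id,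
      Category.id_comp, sub_self, comp_zero]
  exact ⟨S, f, ⟨(coproductIsCoproduct fun _ : S => x).ofIsoColimit
    (Cocone.ext ⟨Sigma.desc f, r, hr, hr'⟩ fun s => by simp)⟩⟩

/-- The Cantor-Bernstein theorem in a Grothendieck category all of whose objects are injective:
two objects are isomorphic if each is a retract of the other. -/
lemma nonempty_iso_of_retracts (hinj : ∀ X : C, Injective X) {x y : C}
    (j : y ⟶ x) (q : x ⟶ y) (hjq : j ≫ q = 𝟙 y) (i : x ⟶ y) [Mono i] : Nonempty (x ≅ y) := by
  let z := kernel q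
  let κ : z ⟶ x := kernel.ι q
  let ρ : x ⟶ z := kernel.lift q (𝟙 x - q ≫ j) (by simp [hjq])
  have hρ : ρ ≫ κ = 𝟙 x - q ≫ j := kernel.lift_ι _ _ _
  have hκq : κ ≫ q = 0 := kernel.condition q
  have hκρ : κ ≫ ρ = 𝟙 z := by
    rw [← cancel_mono κ, Category.assoc, hρ, Preadditive.comp_sub, reassoc_of% hκq]
    simp
  have hjρ : j ≫ ρ = 0 := by
    rw [← cancel_mono κ, Category.assoc, hρ, Preadditive.comp_sub, reassoc_of% hjq]
    simp
  -- `N` is the smallest subobject of `x` that contains `z` and is stable under `i ≫ j`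
  obtain ⟨N, n, c, g, hn, hc, hg, hjoint⟩ : ∃ (N : C) (n : N ⟶ x) (c : z ⟶ N) (g : N ⟶ N),
      Mono n ∧ c ≫ n = κ ∧ g ≫ n = n ≫ i ≫ j ∧
      ∀ (T : C) (a : N ⟶ T), c ≫ a = 0 → g ≫ a = 0 → a = 0 := by
    let pow : ℕ → (z ⟶ x) := Nat.rec κ fun _ a => a ≫ i ≫ j
    let d : (∐ fun _ : ULift.{v} ℕ => z) ⟶ x := Sigma.desc fun m => pow m.down
    let sh : (∐ fun _ : ULift.{v} ℕ => z) ⟶ ∐ fun _ : ULift.{v} ℕ => z :=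
      Sigma.desc fun m => Sigma.ι (fun _ : ULift.{v} ℕ => z) ⟨m.down + 1⟩
    have hsh : sh ≫ d = d ≫ i ≫ j := Sigma.hom_ext _ _ fun m => by simp [sh, d, pow]
    let e := factorThruImage d
    have he : e ≫ image.ι d = d := image.fac d
    have sq : CommSq (sh ≫ e) e (image.ι d) (image.ι d ≫ i ≫ j) :=
      ⟨by rw [Category.assoc, he, hsh, reassoc_of% he]⟩
    refine ⟨image d, image.ι d, Sigma.ι (fun _ : ULift.{v} ℕ => z) ⟨0⟩ ≫ e, sq.lift,
      inferInstance, by simp [he, d, pow], sq.fac_right, fun T a hc hg => ?_⟩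
    rw [← cancel_epi e, comp_zero]
    refine Sigma.hom_ext _ _ fun m => ?_
    obtain ⟨m⟩ := m
    obtain _ | m := m
    · rw [comp_zero, ← hc, Category.assoc]
    · have h1 : sh ≫ e ≫ a = 0 := by
        rw [← Category.assoc, ← sq.fac_left, Category.assoc, hg, comp_zero]
      simpa [sh] using Sigma.ι (fun _ : ULift.{v} ℕ => z) ⟨m⟩ ≫= h1
  obtain ⟨s, hs⟩ := exists_retraction hinj (n ≫ i)
  rw [Category.assoc] at hs
  let π : x ⟶ N := ρ ≫ c + q ≫ s ≫ g
  have hnπ : n ≫ π = 𝟙 N := by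
    rw [← sub_eq_zero]
    -- `N` is generated by `z` and its own shift, so the identity is checked on `c` and `g`.
    refine hjoint _ _ ?_ ?_
    · rw [Preadditive.comp_sub, reassoc_of% hc, Preadditive.comp_add, reassoc_of% hκρ,
        reassoc_of% hκq]
      simp
    · rw [Preadditive.comp_sub, reassoc_of% hg, Preadditive.comp_add, reassoc_of% hjρ,
        reassoc_of% hjq]
      simp only [zero_comp, zero_add, reassoc_of% hs, Category.comp_id, sub_self]
  have hjπ : j ≫ π = s ≫ g := by
    simp only [π, Preadditive.comp_add, reassoc_of% hjρ, reassoc_of% hjq, zero_comp, zero_add]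
  have hπn : π ≫ n = 𝟙 x - q ≫ j + q ≫ s ≫ n ≫ i ≫ j := by
    simp only [π, Preadditive.add_comp, Category.assoc, hc, hg, hρ]
  have hπnq : π ≫ n ≫ q = q ≫ s ≫ n ≫ i := by
    rw [← Category.assoc, hπn]
    simp [hjq]
  -- As in the set-theoretic proof: use `i` on `N` and `q` on the complement `ker π`, which lies in
  -- the copy of `y`.
  refine ⟨⟨π ≫ n ≫ i + q - π ≫ n ≫ q, s ≫ n + j - s ≫ n ≫ i ≫ j, ?_, ?_⟩⟩
  · rw [hπnq]
    simp only [Preadditive.add_comp, Preadditive.sub_comp, Preadditive.comp_add,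
      Preadditive.comp_sub, Category.assoc, reassoc_of% hs]
    rw [hπn]
    abel
  · simp only [Preadditive.add_comp, Preadditive.sub_comp, Preadditive.comp_add,
      Preadditive.comp_sub, Category.assoc, reassoc_of% hs, reassoc_of% hnπ,
      reassoc_of% hjπ, hjq, Category.comp_id]
    abel

/-- In a singleton category, every object is injective. -/
lemma injective_of_forall_iso_sigma {x : C} (hx0 : ¬ IsZero x)
    (hx : ∀ y : C, ∃ S : Type v, Nonempty (y ≅ ∐ fun _ : S => x)) (y : C) : Injective y := by
  classical
  -- `x` is a retract of an injective object
  have hxinj : Injective x := by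
    obtain ⟨S, ⟨φ⟩⟩ := hx (Injective.under x)
    have : Nonempty S := by
      by_contra hS
      rw [not_nonempty_iff] at hS
      have h : 𝟙 (∐ fun _ : S => x) = 0 := Sigma.hom_ext _ _ fun s => isEmptyElim s
      refine hx0 ((IsZero.iff_id_eq_zero x).2 ?_)
      rw [← cancel_mono (Injective.ι x ≫ φ.hom), ← Category.comp_id φ.hom, h]
      simp
    let s := Classical.arbitrary S
    have : Injective (∐ fun _ : S => x) := Injective.of_iso φ inferInstance
    exact Retract.injective ⟨Sigma.ι (fun _ : S => x) s, Sigma.desc fun _ => 𝟙 x, by simp⟩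
  obtain ⟨S, ⟨φ⟩⟩ := hx y
  let J := x ⟶ ∐ fun _ : S => x
  obtain ⟨T, ⟨ψ⟩⟩ := hx (∏ᶜ fun _ : J => x)
  -- Otherwise the power of `x` over `J` embeds in the coproduct over S, and the subsets of `J`,
  -- seen as 0-1 vectors, inject into `J`.
  have hST : Nonempty (S ↪ T) := by
    refine (Function.Embedding.total S T).resolve_right ?_
    rintro ⟨e⟩
    obtain ⟨r, hr⟩ := exists_retraction_subcoproduct x e e.injective
    have : IsSplitMono (Sigma.desc fun t : T => Sigma.ι (fun _ : S => x) (e t)) := ⟨⟨r, hr⟩⟩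
    let w : (∏ᶜ fun _ : J => x) ⟶ ∐ fun _ : S => x :=
      ψ.hom ≫ Sigma.desc fun t : T => Sigma.ι (fun _ : S => x) (e t)
    refine Function.cantor_injective
      (fun A : Set J => (Pi.lift fun a : J => if a ∈ A then 𝟙 x else 0) ≫ w) fun A B hAB => ?_
    have h := (cancel_mono w).1 hAB
    ext a
    have h1 := h =≫ Pi.π _ a
    have h2 : 𝟙 x ≠ 0 := fun h => hx0 ((IsZero.iff_id_eq_zero x).2 h)
    simp only [Pi.lift_π] at h1
    by_cases hA : a ∈ A <;> by_cases hB : a ∈ B <;> simp_all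
  obtain ⟨e⟩ := hST
  obtain ⟨r, hr⟩ := exists_retraction_subcoproduct x e e.injective
  have : Injective (∐ fun _ : T => x) := Injective.of_iso ψ inferInstance
  exact Injective.of_iso φ.symm (Retract.injective ⟨_, r, hr⟩)

/-- The generating object of a singleton category is isominimal. -/
lemma isIsominimalObject_of_forall_iso_sigma {x : C} (hinj : ∀ X : C, Injective X)
    (hx : ∀ y : C, ∃ S : Type v, Nonempty (y ≅ ∐ fun _ : S => x)) : IsIsominimalObject x := by
  intro z i r hir hz
  obtain ⟨S, ⟨φ⟩⟩ := hx z
  have : Nonempty S := by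
    by_contra hS
    rw [not_nonempty_iff] at hS
    have h : 𝟙 (∐ fun _ : S => x) = 0 := Sigma.hom_ext _ _ fun s => isEmptyElim s
    exact hz (((IsZero.iff_id_eq_zero _).2 h).of_iso φ)
  have : IsSplitMono (Sigma.ι (fun _ : S => x) (Classical.arbitrary S)) :=
    ⟨⟨Sigma.desc fun _ => 𝟙 x, by simp⟩⟩
  exact nonempty_iso_of_retracts hinj i r hir
    (Sigma.ι (fun _ : S => x) (Classical.arbitrary S) ≫ φ.inv)

/-- The generating object of a singleton category is a separator. -/
lemma isSeparator_of_forall_iso_sigma {x : C}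
    (hx : ∀ y : C, ∃ S : Type v, Nonempty (y ≅ ∐ fun _ : S => x)) : IsSeparator x := by
  rw [Preadditive.isSeparator_iff]
  intro Y Z f hf
  obtain ⟨S, ⟨φ⟩⟩ := hx Y
  rw [← cancel_epi φ.inv, comp_zero]
  exact Sigma.hom_ext _ _ fun s => by rw [comp_zero, ← Category.assoc, hf]

lemma exists_forall_iso_sigma (hC : ∃ X : C, ¬ IsZero X) (h : IsSingletonCategory C) :
    ∃ x : C, ¬ IsZero x ∧ ∀ y : C, ∃ S : Type v, Nonempty (y ≅ ∐ fun _ : S => x) := by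
  obtain ⟨x, hx⟩ := h
  have hx' (y : C) : ∃ S : Type v, Nonempty (y ≅ ∐ fun _ : S => x) := by
    obtain ⟨S, i, ⟨hi⟩⟩ := hx y
    exact ⟨S, ⟨hi.coconePointUniqueUpToIso (coproductIsCoproduct _)⟩⟩
  refine ⟨x, fun h0 => ?_, hx'⟩
  obtain ⟨X, hX⟩ := hC
  obtain ⟨S, ⟨φ⟩⟩ := hx' X
  refine hX (((IsZero.iff_id_eq_zero _).2 ?_).of_iso φ)
  exact Sigma.hom_ext _ _ fun s => h0.eq_of_src _ _

end

/-! ### Isominimal modules and retracts -/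

section Modules

variable {R : Type v} [Ring R] {M N : Type v} [AddCommGroup M] [Module R M] [AddCommGroup N]
  [Module R N]

/-- An isominimal module is isomorphic to each of its non-zero retracts. -/
lemma nonempty_linearEquiv_of_retract (hM : IsIsominimalModule R M) (i : N →ₗ[R] M)
    (r : M →ₗ[R] N) (hri : r ∘ₗ i = LinearMap.id) [Nontrivial N] : Nonempty (M ≃ₗ[R] N) := by
  have hri' (n : N) : r (i n) = n := LinearMap.congr_fun hri n
  have hi : Function.Injective i := Function.LeftInverse.injective hri'
  have hproj : ∀ m : LinearMap.range i, (i.rangeRestrict ∘ₗ r) m = m := by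
    rintro ⟨_, n, rfl⟩
    exact Subtype.ext (by simp [hri'])
  obtain ⟨φ⟩ := hM (LinearMap.range i) ⟨_, LinearMap.isCompl_of_proj hproj⟩ fun h => by
    obtain ⟨n, hn⟩ := exists_ne (0 : N)
    exact hn (hi (by simp [LinearMap.range_eq_bot.1 h]))
  exact ⟨φ.trans (LinearEquiv.ofInjective i hi).symm⟩

/-- A module that is isomorphic to each of its non-zero retracts is isominimal. -/
lemma isIsominimalModule_of_forall_retract
    (h : ∀ (N : Submodule R M) (r : M →ₗ[R] N), r ∘ₗ N.subtype = LinearMap.id → N ≠ ⊥ →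
      Nonempty (M ≃ₗ[R] N)) : IsIsominimalModule R M := by
  rintro N ⟨N', hN⟩ hbot
  exact h N (N.projectionOnto N' hN) (LinearMap.ext fun n => by simp) hbot

lemma IsIsominimalModule.of_linearEquiv (hM : IsIsominimalModule R M) (φ : M ≃ₗ[R] N) :
    IsIsominimalModule R N := by
  refine isIsominimalModule_of_forall_retract fun L r hr hL => ?_
  have : Nontrivial L := Submodule.nontrivial_iff_ne_bot.2 hL
  obtain ⟨ψ⟩ := nonempty_linearEquiv_of_retract hM (φ.symm.toLinearMap ∘ₗ L.subtype)
    (r ∘ₗ φ.toLinearMap) (LinearMap.ext fun l => by simpa using LinearMap.congr_fun hr l)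
  exact ⟨φ.symm.trans ψ⟩

end Modules

/-! ### Principal right ideals and central idempotents -/

section Ring

variable {A : Type v} [Ring A]

/-- The right `A`-linear endomorphism of `A` given by left multiplication. -/
def leftMulMap (a : A) : A →ₗ[Aᵐᵒᵖ] A where
  toFun b := a * b
  map_add' := mul_add a
  map_smul' _ _ := (mul_assoc _ _ _).symm

lemma mem_principalRightIdeal {x y : A} : y ∈ principalRightIdeal x ↔ ∃ a, y = x * a := by
  rw [principalRightIdeal, Submodule.mem_span_singleton]
  exact ⟨fun ⟨a, ha⟩ => ⟨a.unop, ha.symm⟩, fun ⟨a, ha⟩ => ⟨MulOpposite.op a, ha.symm⟩⟩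

/-- Left multiplication by an idempotent `e`, as a projection onto `e A`. -/
def toPrincipalRightIdeal (e : A) : A →ₗ[Aᵐᵒᵖ] principalRightIdeal e :=
  (leftMulMap e).codRestrict _ fun a => mem_principalRightIdeal.2 ⟨a, rfl⟩

lemma toPrincipalRightIdeal_comp_subtype {e : A} (he : IsIdempotentElem e) :
    toPrincipalRightIdeal e ∘ₗ (principalRightIdeal e).subtype = LinearMap.id := by
  ext ⟨y, hy⟩
  obtain ⟨a, rfl⟩ := mem_principalRightIdeal.1 hy
  change e * (e * a) = e * a
  rw [← mul_assoc, he.eq]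

lemma principalRightIdeal_one : principalRightIdeal (1 : A) = ⊤ :=
  eq_top_iff.2 fun a _ => mem_principalRightIdeal.2 ⟨a, (one_mul a).symm⟩

lemma isIsominimalElement_one (hA : IsIsominimalRing A) : IsIsominimalElement (1 : A) :=
  IsIsominimalModule.of_linearEquiv hA
    ((LinearEquiv.ofTop _ principalRightIdeal_one).symm)

/-- A regular isominimal ring is a factor. -/
lemma isRegularFactor_of_isIsominimalRing (hreg : IsVonNeumannRegular A)
    (hA : IsIsominimalRing A) : IsRegularFactor A := by
  refine ⟨hreg, fun e hcent he => or_iff_not_imp_left.2 fun he0 => ?_⟩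
  have : Nontrivial (principalRightIdeal e) :=
    ⟨⟨e, mem_principalRightIdeal.2 ⟨1, (mul_one e).symm⟩⟩, 0, fun h => he0 (congrArg Subtype.val h)⟩
  obtain ⟨φ⟩ := nonempty_linearEquiv_of_retract hA _ _ (toPrincipalRightIdeal_comp_subtype he)
  obtain ⟨b, hb⟩ := mem_principalRightIdeal.1 (φ 1).2
  -- As `e` is central, `1 - e` annihilates `e A`, hence also the isomorphic module `A`.
  have h : φ (1 - e) = φ 0 := by
    have h1 : φ (1 - e) = MulOpposite.op (1 - e) • φ 1 := by
      rw [← map_smul]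
      exact congrArg φ (one_mul _).symm
    rw [h1, map_zero]
    refine Subtype.ext ?_
    change (φ 1).1 * (1 - e) = 0
    rw [hb, mul_assoc, Subring.mem_center_iff.1 (sub_mem (one_mem _) hcent) b, ← mul_assoc,
      mul_sub, he.eq, mul_one, sub_self, zero_mul]
  exact (sub_eq_zero.1 (φ.injective h)).symm

end Ring

/-! ### The category of summands of powers of A -/

section ReducedModules

variable {A : Type v} [Ring A]

variable (A) in
/-- The ring `A` as an object of the category of reduced modules. -/
def regularObj : ReducedModuleCat A :=
  ⟨ModuleCat.of Aᵐᵒᵖ A, PUnit, LinearMap.pi fun _ => LinearMap.id, LinearMap.proj PUnit.unit, rfl⟩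

/-- The right ideal `e A`, for an idempotent `e`, as an object of the category of reduced
modules. -/
def idempotentObj {e : A} (he : IsIdempotentElem e) : ReducedModuleCat A :=
  ⟨ModuleCat.of Aᵐᵒᵖ (principalRightIdeal e), PUnit,
    LinearMap.pi fun _ => (principalRightIdeal e).subtype,
    toPrincipalRightIdeal e ∘ₗ LinearMap.proj PUnit.unit, toPrincipalRightIdeal_comp_subtype he⟩

/-- The morphism of reduced modules attached to a linear map. -/
def homOfLinearMap {M N : ReducedModuleCat A} (f : M.obj →ₗ[Aᵐᵒᵖ] N.obj) : M ⟶ N :=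
  ObjectProperty.homMk (ModuleCat.ofHom f)

/-- The morphism from the regular module that sends `1` to the given element. -/
def homOfElement {M : ReducedModuleCat A} (m : M.obj) : regularObj A ⟶ M :=
  homOfLinearMap
    { toFun := fun a : A => MulOpposite.op a • m
      map_add' := fun (a b : A) => add_smul (MulOpposite.op a) (MulOpposite.op b) m
      map_smul' := fun a b => mul_smul a (MulOpposite.op b) m }

lemma homOfElement_comp_apply_one {M N : ReducedModuleCat A} (m : M.obj) (f : M ⟶ N) :
    (homOfElement m ≫ f).hom.hom (1 : A) = f.hom.hom m := by
  change f.hom.hom (MulOpposite.op (1 : A) • m) = _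
  rw [MulOpposite.op_one, one_smul]

lemma homOfElement_eq {M : ReducedModuleCat A} (f : regularObj A ⟶ M) :
    f = homOfElement (f.hom.hom (1 : A)) := by
  refine ObjectProperty.hom_ext _ (ModuleCat.hom_ext (LinearMap.ext fun (a : A) => ?_))
  change f.hom.hom a = MulOpposite.op a • f.hom.hom (1 : A)
  exact (congrArg f.hom.hom (one_mul a).symm).trans
    (f.hom.hom.map_smul (MulOpposite.op a) (1 : A))

lemma isSeparator_regularObj : IsSeparator (regularObj A) := by
  rw [isSeparator_def]
  intro M N f g h
  ext m
  rw [← homOfElement_comp_apply_one m f, ← homOfElement_comp_apply_one m g, h]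

lemma injective_of_mono_reducedModule {M N : ReducedModuleCat A} (f : M ⟶ N) [Mono f] :
    Function.Injective f.hom.hom := by
  intro m m' h
  have h1 : homOfElement m = homOfElement m' := by
    rw [← cancel_mono f, homOfElement_eq (homOfElement m ≫ f),
      homOfElement_eq (homOfElement m' ≫ f), homOfElement_comp_apply_one,
      homOfElement_comp_apply_one, h]
  have h2 := homOfElement_comp_apply_one m (𝟙 M)
  rw [h1, homOfElement_comp_apply_one] at h2
  exact h2.symm

/-- Powers of an injective module and their retracts are injective; monomorphisms here are injective
maps because `A` is a separator. -/
lemma injective_reducedModule (hA : IsRightSelfInjective A) (M : ReducedModuleCat A) :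
    Injective M := by
  refine ⟨fun {X Y} g f hf => ?_⟩
  obtain ⟨I, i, r, hri⟩ := M.property
  have : Module.Injective Aᵐᵒᵖ A := hA
  obtain ⟨h, hh⟩ := Module.Injective.extension_property Aᵐᵒᵖ (I → A) X.obj Y.obj f.hom.hom
    (injective_of_mono_reducedModule f) (i ∘ₗ g.hom.hom)
  refine ⟨homOfLinearMap (r ∘ₗ h), ?_⟩
  ext m
  change r (h (f.hom.hom m)) = _
  have h1 : h (f.hom.hom m) = i (g.hom.hom m) := LinearMap.congr_fun hh m
  rw [h1]
  exact LinearMap.congr_fun hri _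

lemma nontrivial_of_not_isZero {M : ReducedModuleCat A} (hM : ¬ IsZero M) : Nontrivial M.obj := by
  by_contra h
  rw [not_nontrivial_iff_subsingleton] at h
  refine hM ((IsZero.iff_id_eq_zero M).2 ?_)
  ext m
  exact Subsingleton.elim _ _

lemma isIsominimalObject_idempotentObj {e : A} (he : IsIdempotentElem e)
    (h : IsIsominimalElement e) : IsIsominimalObject (idempotentObj he) := by
  intro Z i r hir hZ
  have := nontrivial_of_not_isZero hZ
  obtain ⟨φ⟩ := nonempty_linearEquiv_of_retract (N := Z.obj) h i.hom.hom r.hom.hom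
    (LinearMap.ext fun m => congrArg (fun f : Z ⟶ Z => f.hom.hom m) hir)
  exact ⟨ObjectProperty.isoMk _ φ.toModuleIso⟩

lemma not_isZero_idempotentObj {e : A} (he : IsIdempotentElem e) (he0 : e ≠ 0) :
    ¬ IsZero (idempotentObj he) := fun h => he0 (by
  have h1 := congrArg (fun f : idempotentObj he ⟶ idempotentObj he =>
    (f.hom.hom (⟨e, mem_principalRightIdeal.2 ⟨1, (mul_one e).symm⟩⟩ : principalRightIdeal e)))
      ((IsZero.iff_id_eq_zero _).1 h)
  exact congrArg Subtype.val h1)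

/-- Central idempotent endomorphisms of the regular module of a factor are trivial. -/
lemma eq_zero_or_eq_id_of_central (hA : IsRegularFactor A) (p : regularObj A ⟶ regularObj A)
    (hp : p ≫ p = p) (hcomm : ∀ a : regularObj A ⟶ regularObj A, p ≫ a = a ≫ p) :
    p = 0 ∨ p = 𝟙 _ := by
  obtain ⟨c, rfl⟩ : ∃ c : A, p = homOfElement (M := regularObj A) c := ⟨_, homOfElement_eq p⟩
  have hcomp (a b : A) : homOfElement (M := regularObj A) a ≫ homOfElement (M := regularObj A) b =
      homOfElement (M := regularObj A) (b * a) := by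
    rw [homOfElement_eq (homOfElement (M := regularObj A) a ≫ _)]
    exact congrArg (homOfElement (M := regularObj A))
      (homOfElement_comp_apply_one (M := regularObj A) a _)
  have hinj {a b : A} (h : homOfElement (M := regularObj A) a = homOfElement (M := regularObj A) b) :
      a = b := by
    have := congrArg (fun f : regularObj A ⟶ regularObj A => f.hom.hom (1 : A)) h
    change a * 1 = b * 1 at this
    simpa using this
  have hc : c ∈ Subring.center A := Subring.mem_center_iff.2 fun a => hinj (by
    rw [← hcomp, ← hcomp, hcomm])
  obtain rfl | rfl := hA.central_idempotent c hc (hinj (by rw [← hcomp, hp]))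
  · left
    refine ObjectProperty.hom_ext _ (ModuleCat.hom_ext (LinearMap.ext fun (a : A) => ?_))
    exact zero_mul a
  · right
    refine ObjectProperty.hom_ext _ (ModuleCat.hom_ext (LinearMap.ext fun (a : A) => ?_))
    exact one_mul a

end ReducedModules

/-! ### From a factor to a singleton category -/

section Transport

lemma IsIsominimalObject.inverse_obj {C : Type*} [Category* C] {D : Type*} [Category* D]
    [HasZeroMorphisms C] [HasZeroMorphisms D] (E : C ≌ D) {x : D} (hx : IsIsominimalObject x) :
    IsIsominimalObject (E.inverse.obj x) := by
  intro z i r hir hz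
  obtain ⟨φ⟩ := hx (E.functor.obj z) (E.functor.map i ≫ E.counit.app x)
    (E.counitInv.app x ≫ E.functor.map r)
    (by simp [← Functor.map_comp, hir])
    fun h => hz ((E.inverse.map_isZero h).of_iso (E.unitIso.app z))
  exact ⟨E.inverse.mapIso φ ≪≫ (E.unitIso.app z).symm⟩

variable {C : Type u} [Category.{v} C] [Abelian C] [IsGrothendieckAbelian.{v} C]

lemma isSingletonCategory_of_equivalence {A : Type v} [Ring A] (E : C ≌ ReducedModuleCat A)
    (hA : IsRegularFactor A) (hinj : IsRightSelfInjective A) {e : A} (he0 : e ≠ 0)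
    (he : IsIdempotentElem e) (hiso : IsIsominimalElement e) : IsSingletonCategory C := by
  have hC (X : C) : Injective X :=
    (E.map_injective_iff X).1 (injective_reducedModule hinj _)
  have hx := (isIsominimalObject_idempotentObj he hiso).inverse_obj E
  have hx0 : ¬ IsZero (E.inverse.obj (idempotentObj he)) := fun h =>
    not_isZero_idempotentObj he he0 ((E.functor.map_isZero h).of_iso (E.counitIso.app _).symm)
  let i : idempotentObj he ⟶ regularObj A := homOfLinearMap (principalRightIdeal e).subtype
  let q : regularObj A ⟶ idempotentObj he := homOfLinearMap (toPrincipalRightIdeal e)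
  have hiq : i ≫ q = 𝟙 _ := by
    ext m
    exact LinearMap.congr_fun (toPrincipalRightIdeal_comp_subtype he) m
  refine hx.isSingletonCategory hC hx0 (hx.isSeparator_of_central hC
    (isSeparator_regularObj.of_equivalence E.symm) hx0 (E.inverse.map i) (E.inverse.map q)
    (by rw [← Functor.map_comp, hiq, CategoryTheory.Functor.map_id]) fun p hp hcomm => ?_)
  obtain ⟨p, rfl⟩ := E.inverse.map_surjective p
  obtain rfl | rfl := eq_zero_or_eq_id_of_central hA p
    (E.inverse.map_injective (by simpa using hp))
    fun a => E.inverse.map_injective (by simpa using hcomm (E.inverse.map a))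
  · exact Or.inl (E.inverse.map_zero _ _)
  · exact Or.inr (E.inverse.map_id _)

end Transport

/-! ### The endomorphism ring of the generating object -/

section Endomorphisms

variable {C : Type u} [Category.{v} C] [Abelian C]

lemma isVonNeumannRegular_end (hinj : ∀ X : C, Injective X) (x : C) :
    IsVonNeumannRegular (End x) := fun f => by
  obtain ⟨g, hg⟩ := exists_quasiInverse hinj (X := x) (Y := x) f
  exact ⟨g, hg.symm⟩

variable [IsGrothendieckAbelian.{v} C]

/-- By Gabriel-Popescu, Hom(x, -) preserves injective objects; its value at `x` is the regular
module. -/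
lemma isRightSelfInjective_end {x : C} [Injective x] (hx : IsSeparator x) :
    IsRightSelfInjective (End x) := by
  have := IsGrothendieckAbelian.GabrielPopescu.preservesInjectiveObjects x hx
  have h : Injective ((preadditiveCoyonedaObj x).obj x) :=
    Functor.PreservesInjectiveObjects.injective_obj inferInstance
  exact (Module.injective_iff_injective_object _ _).2 h

/-- Morphisms from `x` into a power of `x` form a power of the endomorphism ring. -/
noncomputable def homPiEquiv (x : C) (I : Type v) :
    (x ⟶ ∏ᶜ fun _ : I => x) ≃ₗ[(End x)ᵐᵒᵖ] (I → End x) where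
  toFun g j := g ≫ Pi.π _ j
  map_add' g h := funext fun j => Preadditive.add_comp _ _ _ _ _ _
  map_smul' a g := funext fun j => Category.assoc _ _ _
  invFun h := Pi.lift h
  left_inv g := Pi.hom_ext _ _ fun j => by simp
  right_inv h := funext fun j => by simp

lemma isReducedModule_hom (hinj : ∀ X : C, Injective X) {x : C}
    (hx : ∀ y : C, ∃ S : Type v, Nonempty (y ≅ ∐ fun _ : S => x)) (y : C) :
    IsReducedModule (End x) ((preadditiveCoyonedaObj x).obj y) := by
  obtain ⟨S, ⟨φ⟩⟩ := hx y
  obtain ⟨f, hf⟩ := mono_sigma_to_pi S x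
  obtain ⟨r, hr⟩ := exists_retraction hinj (φ.hom ≫ f)
  refine ⟨S, (homPiEquiv x S).toLinearMap ∘ₗ
      ((preadditiveCoyonedaObj x).map (φ.hom ≫ f)).hom,
    ((preadditiveCoyonedaObj x).map r).hom ∘ₗ (homPiEquiv x S).symm.toLinearMap,
    LinearMap.ext fun (g : x ⟶ y) => ?_⟩
  change (homPiEquiv x S).symm (homPiEquiv x S (g ≫ φ.hom ≫ f)) ≫ r = g
  exact (congrArg (· ≫ r) ((homPiEquiv x S).symm_apply_apply _)).trans (by
    rw [Category.assoc, hr, Category.comp_id])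

lemma exists_iso_of_isReducedModule {x : C} (hx : IsSeparator x)
    (M : ModuleCat.{v} (End x)ᵐᵒᵖ) (hM : IsReducedModule (End x) M) :
    ∃ y : C, Nonempty ((preadditiveCoyonedaObj x).obj y ≅ M) := by
  have := IsGrothendieckAbelian.GabrielPopescu.full x hx
  have := (isSeparator_iff_faithful_preadditiveCoyonedaObj x).1 hx
  obtain ⟨I, i, r, hri⟩ := hM
  let F := preadditiveCoyonedaObj x
  obtain ⟨i', r', hri'⟩ : ∃ (i' : M ⟶ F.obj (∏ᶜ fun _ : I => x))
      (r' : F.obj (∏ᶜ fun _ : I => x) ⟶ M), i' ≫ r' = 𝟙 M := by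
    refine ⟨ModuleCat.ofHom ((homPiEquiv x I).symm.toLinearMap ∘ₗ i),
      ModuleCat.ofHom (r ∘ₗ (homPiEquiv x I).toLinearMap),
      ModuleCat.hom_ext (LinearMap.ext fun m => ?_)⟩
    change r (homPiEquiv x I ((homPiEquiv x I).symm (i m))) = m
    rw [LinearEquiv.apply_symm_apply]
    exact LinearMap.congr_fun hri m
  -- The idempotent cutting out `M` lifts to an idempotent of the power of `x`, which splits in `C`.
  obtain ⟨p, hp⟩ := F.map_surjective (r' ≫ i')
  obtain ⟨Y, j, q, hjq, hqj⟩ := IsIdempotentComplete.idempotents_split _ p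
    (F.map_injective (by rw [F.map_comp, hp, Category.assoc, reassoc_of% hri']))
  refine ⟨Y, ⟨⟨F.map j ≫ r', i' ≫ F.map q, ?_, ?_⟩⟩⟩
  · calc (F.map j ≫ r') ≫ i' ≫ F.map q = F.map j ≫ (r' ≫ i') ≫ F.map q := by
          simp only [Category.assoc]
      _ = F.map ((j ≫ q) ≫ (j ≫ q)) := by
          rw [← hp, ← hqj]; simp only [Functor.map_comp, Category.assoc]
      _ = 𝟙 _ := by rw [hjq, Category.comp_id, F.map_id]
  · calc (i' ≫ F.map q) ≫ F.map j ≫ r' = i' ≫ F.map (q ≫ j) ≫ r' := by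
          simp only [Functor.map_comp, Category.assoc]
      _ = 𝟙 _ := by
          rw [hqj, hp]
          simp only [Category.assoc, reassoc_of% hri', hri']

lemma equivReducedModuleCat_end (k : Type t) [CommRing k] [Linear k C]
    (hinj : ∀ X : C, Injective X) {x : C} (hsep : IsSeparator x)
    (hx : ∀ y : C, ∃ S : Type v, Nonempty (y ≅ ∐ fun _ : S => x)) :
    EquivReducedModuleCat k C (End x) := by
  have := IsGrothendieckAbelian.GabrielPopescu.full x hsep
  have := (isSeparator_iff_faithful_preadditiveCoyonedaObj x).1 hsep
  let F : C ⥤ ReducedModuleCat (End x) :=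
    (IsReducedModule (End x)).lift (preadditiveCoyonedaObj x) (isReducedModule_hom hinj hx)
  have : F.EssSurj := ⟨fun M => by
    obtain ⟨y, ⟨φ⟩⟩ := exists_iso_of_isReducedModule hsep M.obj M.property
    exact ⟨y, ⟨ObjectProperty.isoMk _ φ⟩⟩⟩
  have : F.IsEquivalence := {}
  refine ⟨F.asEquivalence, fun X Y f r (m : x ⟶ X) => ?_⟩
  change m ≫ (r • f) = (r • 𝟙 x) ≫ m ≫ f
  rw [Linear.comp_smul, Linear.smul_comp, Category.id_comp]

/-- Retracts of the regular module come from retracts of `x`, as Hom(x, -) is fully faithful. -/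
lemma isIsominimalRing_end {x : C} (hsep : IsSeparator x) (hx : IsIsominimalObject x) :
    IsIsominimalRing (End x) := by
  have := IsGrothendieckAbelian.GabrielPopescu.full x hsep
  have := (isSeparator_iff_faithful_preadditiveCoyonedaObj x).1 hsep
  let F := preadditiveCoyonedaObj x
  refine isIsominimalModule_of_forall_retract fun N r hr hN => ?_
  obtain ⟨y, ⟨φ⟩⟩ := exists_iso_of_isReducedModule hsep (ModuleCat.of _ N)
    ⟨PUnit, LinearMap.pi fun _ => N.subtype, r ∘ₗ LinearMap.proj PUnit.unit, hr⟩
  let i' : ModuleCat.of (End x)ᵐᵒᵖ N ⟶ F.obj x := ModuleCat.ofHom N.subtype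
  let r' : F.obj x ⟶ ModuleCat.of (End x)ᵐᵒᵖ N := ModuleCat.ofHom r
  have hir : i' ≫ r' = 𝟙 _ := ModuleCat.hom_ext hr
  obtain ⟨j, hj⟩ := F.map_surjective (φ.hom ≫ i')
  obtain ⟨q, hq⟩ := F.map_surjective (r' ≫ φ.inv)
  obtain ⟨ψ⟩ := hx y j q (F.map_injective (by
    rw [F.map_comp, hj, hq, Category.assoc, reassoc_of% hir, φ.hom_inv_id, F.map_id])) fun hy => by
      obtain ⟨n, hn⟩ := Submodule.nonzero_mem_of_bot_lt (bot_lt_iff_ne_bot.2 hN)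
      refine hn (φ.toLinearEquiv.symm.injective ?_)
      exact hy.eq_of_tgt (Y := x) _ _
  exact ⟨(F.mapIso ψ ≪≫ φ).toLinearEquiv⟩

end Endomorphisms

end SingletonCategory

open SingletonCategory in
theorem theorem3 (k : Type t) [CommRing k]
    (C : Type u) [Category.{v} C] [Abelian C] [Linear k C] [IsGrothendieckAbelian.{v} C]
    (hC : ∃ X : C, ¬ IsZero X) :
    List.TFAE [
      IsSingletonCategory C,
      ∃ (A : Type v) (_ : Ring A) (_ : Algebra k A),
        Nontrivial A ∧ IsVonNeumannRegular A ∧ IsIsominimalRing A ∧ IsRightSelfInjective A ∧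
          EquivReducedModuleCat k C A,
      ∃ (A : Type v) (_ : Ring A) (_ : Algebra k A),
        IsRegularFactor A ∧ IsRightSelfInjective A ∧
          (∃ e : A, e ≠ 0 ∧ IsIdempotentElem e ∧ IsIsominimalElement e) ∧
          EquivReducedModuleCat k C A] := by
  tfae_have 1 → 2 := fun h => by
    obtain ⟨x, hx0, hx⟩ := exists_forall_iso_sigma hC h
    have hinj := injective_of_forall_iso_sigma hx0 hx
    have hsep := isSeparator_of_forall_iso_sigma hx
    refine ⟨End x, inferInstance, inferInstance,
      ⟨𝟙 x, 0, fun h => hx0 ((IsZero.iff_id_eq_zero x).2 h)⟩, isVonNeumannRegular_end hinj x,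
      isIsominimalRing_end hsep (isIsominimalObject_of_forall_iso_sigma hinj hx),
      isRightSelfInjective_end hsep, equivReducedModuleCat_end k hinj hsep hx⟩
  tfae_have 2 → 3 := by
    rintro ⟨A, _, _, _, hreg, hiso, hinj, hE⟩
    exact ⟨A, inferInstance, inferInstance, isRegularFactor_of_isIsominimalRing hreg hiso, hinj,
      ⟨1, one_ne_zero, IsIdempotentElem.one, isIsominimalElement_one hiso⟩, hE⟩
  tfae_have 3 → 1 := by
    rintro ⟨A, _, _, hA, hinj, ⟨e, he0, he, hiso⟩, E, -⟩
    exact isSingletonCategory_of_equivalence E hA hinj he0 he hiso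
  tfae_finish
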